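/- Let $p$ be a prime, let $P$ be a finite $p$-group and let $\mathbb F_p$ be the field with $p$ elements. Let $CS_{\mathbb F_p}(P)$ be the abelian category of coefficient systems on $P$ over $\mathbb F_p$, that is, of contravariant functors from the orbit category of $P$ (whose objects are the transitive $P$-sets $P/H$ with $H\le P$, and whose morphisms are the $P$-equivariant maps) to $\mathbb F_p$-modules. If $E$ and $F$ are projective objects of $CS_{\mathbb F_p}(P)$, not necessarily finitely generated, and $f\colon E\to F$ is a monomorphism, then $f$ is split, i.e. there is a morphism $r\colon F\to E$ with $r\circ f=\mathrm{id}_E$. -/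

import Mathlib

open CategoryTheory

universe w u v

/-- The orbit category of a group `G`: an object is a subgroup `H` of `G`, standing for the
transitive `G`-set `G ⧸ H`. (This is a structure so that its morphisms are not confused with
the inclusions between subgroups.) -/
structure OrbitCategory (G : Type*) [Group G] where
  /-- the subgroup `H` for which the object stands -/
  subgroup : Subgroup G

/-- Morphisms `K ⟶ H` in the orbit category are the `G`-equivariant maps `G ⧸ K → G ⧸ H`. -/
instance OrbitCategory.category (G : Type*) [Group G] : Category (OrbitCategory G) where
  Hom K H := (G ⧸ K.subgroup) →[G] (G ⧸ H.subgroup)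
  id H := MulActionHom.id G
  comp f g := MulActionHom.comp g f

/-- The category `CS_R(G)` of coefficient systems on `G` over `R`: contravariant functors from
the orbit category to `R`-modules, with natural transformations as morphisms. Writing `L(H)` for
the value at `G ⧸ H`, the restriction `L(H) → L(K)` for `K ≤ H` is induced by the projection
`G ⧸ K → G ⧸ H`, and the conjugation `c_g : L(H) → L(gHg⁻¹)` by the map
`G ⧸ gHg⁻¹ → G ⧸ H`, `x(gHg⁻¹) ↦ xgH`. -/
abbrev CoefficientSystem (G : Type u) [Group G] (R : Type v) [Ring R] :=
  (OrbitCategory G)ᵒᵖ ⥤ ModuleCat.{w} R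

/-! The transfer at X sums all restrictions from X to the free orbit. Restricting along φ first
multiplies the transfer by the fibre size of φ, a power of p, hence by zero over 𝔽_p unless φ is
invertible (`transfer_map`, `cast_degree_div_eq_zero_or_isIso`). So the transfer images of E form a
quotient system, and linear retractions of f on these subspaces are automatically natural.
Projectivity of F lifts them to r : F ⟶ E such that e = f ≫ r preserves transfers.

As E is a summand of a free system, invariants at the free orbit are sums of transfers
(`exists_eq_sum_transfer`), so e - 1 kills them and is locally nilpotent, P being a p-group.
Restrictions to the free orbit are injective, so e - 1 is locally nilpotent everywhere, and e is
invertible. -/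

section Representation

/-! ### Representations of p-groups in characteristic p -/

variable {p : ℕ} [Fact p.Prime] {G V : Type*} [Group G] [AddCommGroup V] [Module (ZMod p) V]

/-- A nonzero representation of a finite `p`-group over `𝔽_p` has a nonzero invariant vector. -/
theorem IsPGroup.exists_ne_zero_invariant [Finite G] (hG : IsPGroup p G)
    (ρ : Representation (ZMod p) G V) [Nontrivial V] : ∃ v : V, v ≠ 0 ∧ ∀ g, ρ g v = v := by
  obtain ⟨v, hv⟩ := exists_ne (0 : V)
  -- V may be infinite; the span of one orbit is finite, so fixed points can be counted mod p.
  let N : Submodule (ZMod p) V := Submodule.span (ZMod p) (Set.range fun g => ρ g v)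
  have hN : ∀ g, ∀ x ∈ N, ρ g x ∈ N := by
    intro g x hx
    induction hx using Submodule.span_induction with
    | mem x hx =>
      obtain ⟨g', rfl⟩ := hx
      refine Submodule.subset_span ⟨g * g', ?_⟩
      simp
    | zero => simp
    | add x y _ _ hx hy => rw [map_add]; exact N.add_mem hx hy
    | smul a x _ hx => rw [map_smul]; exact N.smul_mem a hx
  have : Module.Finite (ZMod p) N := Module.Finite.span_of_finite _ (Set.finite_range _)
  have : Finite N := Module.finite_of_finite (ZMod p)
  let _ : MulAction G N :=
    { smul g x := ⟨ρ g x, hN g x x.2⟩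
      one_smul x := Subtype.ext (by change ρ 1 (x : V) = x; simp)
      mul_smul g g' x := Subtype.ext (by change ρ (g * g') (x : V) = ρ g (ρ g' x); simp) }
  have hvN : v ∈ N := Submodule.subset_span ⟨1, by simp⟩
  have : Nontrivial N := ⟨⟨v, hvN⟩, 0, fun h => hv (congrArg Subtype.val h)⟩
  have hdvd : p ∣ Nat.card N := by
    rw [Module.natCard_eq_pow_finrank (K := ZMod p), Nat.card_zmod]
    exact dvd_pow_self p Module.finrank_pos.ne'
  obtain ⟨b, hb, hne⟩ := hG.exists_fixed_point_of_prime_dvd_card_of_fixed_point N hdvd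
    (a := 0) (fun g => Subtype.ext (map_zero (ρ g)))
  exact ⟨b, fun h => hne (Subtype.ext h.symm), fun g => congrArg Subtype.val (hb g)⟩

/-- An endomorphism of a representation of a finite `p`-group over `𝔽_p` which kills all the
invariants is locally nilpotent. -/
theorem IsPGroup.exists_pow_apply_eq_zero [Finite G] (hG : IsPGroup p G)
    (ρ : Representation (ZMod p) G V) (h : Module.End (ZMod p) V)
    (hcomm : ∀ g v, h (ρ g v) = ρ g (h v))
    (hinv : ∀ v, (∀ g, ρ g v = v) → h v = 0) (v : V) : ∃ n : ℕ, (h ^ n) v = 0 := by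
  have hpow : ∀ (n : ℕ) g v, (h ^ n) (ρ g v) = ρ g ((h ^ n) v) := by
    intro n g
    induction n with
    | zero => simp
    | succ n ih => intro v; rw [pow_succ, Module.End.mul_apply, hcomm, ih, Module.End.mul_apply]
  let U := h.maxGenEigenspace 0
  have hU : ∀ v, v ∈ U ↔ ∃ n : ℕ, (h ^ n) v = 0 := by
    intro v
    simp [U, Module.End.mem_maxGenEigenspace]
  have hρ : ∀ g, U ≤ U.comap (ρ g) := by
    intro g x hx
    obtain ⟨n, hn⟩ := (hU x).1 hx
    exact (hU _).2 ⟨n, by rw [hpow, hn, map_zero]⟩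
  rw [← hU]
  by_contra hv
  have : Nontrivial (V ⧸ U) :=
    ⟨U.mkQ v, 0, fun h0 => hv ((Submodule.Quotient.mk_eq_zero U).1 h0)⟩
  obtain ⟨x, hx0, hx⟩ := hG.exists_ne_zero_invariant (ρ.quotient U hρ)
  obtain ⟨y, rfl⟩ := U.mkQ_surjective x
  have hy : ∀ g, ∃ n : ℕ, (h ^ n) (ρ g y - y) = 0 := by
    intro g
    rw [← hU]
    exact (Submodule.Quotient.eq U).1 (hx g)
  -- Since G is finite, a single power of h kills every ρ g y - y, making that power of h at y
  -- invariant.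
  choose n hn using hy
  obtain ⟨m, hm⟩ := (Set.finite_range n).bddAbove
  have hfix : ∀ g, ρ g ((h ^ m) y) = (h ^ m) y := by
    intro g
    rw [← hpow, ← sub_eq_zero, ← map_sub]
    exact Module.End.pow_map_zero_of_le (hm ⟨g, rfl⟩) (hn g)
  apply hx0
  refine (Submodule.Quotient.mk_eq_zero U).2 ((hU y).2 ⟨m + 1, ?_⟩)
  rw [pow_succ', Module.End.mul_apply]
  exact hinv _ hfix

end Representation

/-- The geometric series in -h is a finite sum at each vector. -/
theorem Module.End.bijective_one_add_of_locally_nilpotent {R V : Type*} [Ring R] [AddCommGroup V]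
    [Module R V] (h : Module.End R V) (hh : ∀ v, ∃ n : ℕ, (h ^ n) v = 0) :
    Function.Bijective (1 + h : Module.End R V) := by
  have hneg : ∀ (n : ℕ) v, (h ^ n) v = 0 → ((-h) ^ n) v = 0 := by
    intro n v hv
    rw [neg_pow, Module.End.mul_apply, hv, map_zero]
  have h1 : 1 + h = 1 - -h := by rw [sub_neg_eq_add]
  constructor
  · rw [injective_iff_map_eq_zero]
    intro v hv
    obtain ⟨n, hn⟩ := hh v
    have := LinearMap.congr_fun (geom_sum_mul_neg (-h) n) v
    rw [← h1, Module.End.mul_apply, hv, map_zero, LinearMap.sub_apply, hneg n v hn] at this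
    simpa using this.symm
  · intro v
    obtain ⟨n, hn⟩ := hh v
    refine ⟨(∑ i ∈ Finset.range n, (-h) ^ i) v, ?_⟩
    have := LinearMap.congr_fun (mul_neg_geom_sum (-h) n) v
    rw [← h1, Module.End.mul_apply, LinearMap.sub_apply, hneg n v hn] at this
    simpa using this

/-! ### Orbits, their morphisms and fibre sizes -/

namespace OrbitCategory

section Group

variable {G : Type u} [Group G]

/-- A morphism of the orbit category as an equivariant map. -/
def toMap {X Y : OrbitCategory G} (φ : X ⟶ Y) : (G ⧸ X.subgroup) →[G] (G ⧸ Y.subgroup) := φ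

theorem hom_ext_of_apply_eq {X Y : OrbitCategory G} {φ ψ : X ⟶ Y} (x : G ⧸ X.subgroup)
    (h : toMap φ x = toMap ψ x) : φ = ψ := by
  refine MulActionHom.ext (f := toMap φ) (g := toMap ψ) fun y => ?_
  obtain ⟨g, rfl⟩ := MulAction.exists_smul_eq G x y
  rw [map_smul, map_smul, h]

theorem toMap_surjective {X Y : OrbitCategory G} (φ : X ⟶ Y) : Function.Surjective (toMap φ) := by
  intro y
  obtain ⟨g, hg⟩ := MulAction.exists_smul_eq G (toMap φ (1 : G)) y
  exact ⟨g • ((1 : G) : G ⧸ X.subgroup), by rw [map_smul, hg]⟩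

instance epi_hom {X Y : OrbitCategory G} (φ : X ⟶ Y) : Epi φ where
  left_cancellation _ _ h :=
    hom_ext_of_apply_eq (toMap φ (1 : G)) (congrArg (fun f => toMap f (1 : G)) h)

theorem isIso_of_bijective {X Y : OrbitCategory G} (φ : X ⟶ Y)
    (h : Function.Bijective (toMap φ)) : IsIso φ := by
  let e := Equiv.ofBijective _ h
  refine ⟨(toMap φ).inverse e.symm e.left_inv e.right_inv, ?_, ?_⟩
  · exact MulActionHom.ext fun x => e.left_inv x
  · exact MulActionHom.ext fun x => e.right_inv x

variable (G) in
/-- The object of the orbit category standing for the free transitive `G`-set. -/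
def free : OrbitCategory G := ⟨⊥⟩

/-- The equivariant map from the free transitive `G`-set which sends `1` to a given point. -/
def ofPoint {X : OrbitCategory G} (x : G ⧸ X.subgroup) : free G ⟶ X where
  toFun y := (QuotientGroup.quotientBot : G ⧸ (⊥ : Subgroup G) ≃* G) y • x
  map_smul' g y := by
    induction y using QuotientGroup.induction_on with
    | H y => exact mul_smul g y x

@[simp]
theorem toMap_ofPoint {X : OrbitCategory G} (x : G ⧸ X.subgroup) (g : G) :
    toMap (ofPoint x) (g : G ⧸ (⊥ : Subgroup G)) = g • x := rfl

/-- Maps out of the free transitive `G`-set correspond to points. -/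
def freeHomEquiv (X : OrbitCategory G) : (free G ⟶ X) ≃ (G ⧸ X.subgroup) where
  toFun ψ := toMap ψ ((1 : G) : G ⧸ (⊥ : Subgroup G))
  invFun := ofPoint
  left_inv _ := hom_ext_of_apply_eq ((1 : G) : G ⧸ (⊥ : Subgroup G))
    ((toMap_ofPoint _ 1).trans (one_smul G _))
  right_inv x := (toMap_ofPoint x 1).trans (one_smul G x)

/-- Right multiplication by `g` on the free transitive `G`-set. -/
def rightMul (g : G) : free G ⟶ free G := ofPoint (X := free G) (g : G ⧸ (⊥ : Subgroup G))

theorem freeHomEquiv_rightMul_comp {X : OrbitCategory G} (g : G) (ψ : free G ⟶ X) :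
    freeHomEquiv X (rightMul g ≫ ψ) = g • freeHomEquiv X ψ := by
  have h : toMap ψ (g • ((1 : G) : G ⧸ (⊥ : Subgroup G))) = g • freeHomEquiv X ψ := map_smul _ _ _
  rw [← h]
  change toMap ψ ((1 : G) • (g : G ⧸ (⊥ : Subgroup G))) = _
  rw [one_smul]
  congr 1
  exact congrArg _ (mul_one g).symm

theorem rightMul_one : rightMul (1 : G) = 𝟙 (free G) :=
  (freeHomEquiv _).injective (by
    rw [← Category.comp_id (rightMul 1), freeHomEquiv_rightMul_comp, one_smul])

theorem rightMul_mul (g h : G) : rightMul (g * h) = rightMul g ≫ rightMul h :=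
  (freeHomEquiv _).injective (by
    rw [freeHomEquiv_rightMul_comp, ← Category.comp_id (rightMul (g * h)),
      ← Category.comp_id (rightMul h), freeHomEquiv_rightMul_comp, freeHomEquiv_rightMul_comp,
      mul_smul])

theorem exists_rightMul_comp_eq {X : OrbitCategory G} (ψ χ : free G ⟶ X) :
    ∃ g : G, rightMul g ≫ ψ = χ := by
  obtain ⟨g, hg⟩ := MulAction.exists_smul_eq G (freeHomEquiv X ψ) (freeHomEquiv X χ)
  exact ⟨g, (freeHomEquiv X).injective (by rw [freeHomEquiv_rightMul_comp, hg])⟩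

theorem rightMul_inv_comp_rightMul_comp {X : OrbitCategory G} (g : G) (ψ : free G ⟶ X) :
    rightMul g⁻¹ ≫ rightMul g ≫ ψ = ψ := by
  rw [← Category.assoc, ← rightMul_mul, inv_mul_cancel, rightMul_one, Category.id_comp]

/-- Precomposition with right multiplication by `g`, as a permutation. -/
def rightMulEquiv (g : G) (X : OrbitCategory G) : (free G ⟶ X) ≃ (free G ⟶ X) where
  toFun ψ := rightMul g ≫ ψ
  invFun ψ := rightMul g⁻¹ ≫ ψ
  left_inv ψ := rightMul_inv_comp_rightMul_comp g ψ
  right_inv ψ := by simpa using rightMul_inv_comp_rightMul_comp g⁻¹ ψ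

/-- All fibres of a morphism have the same size. -/
theorem card_fibre_eq {X Y : OrbitCategory G} (φ : X ⟶ Y) (χ χ' : free G ⟶ Y) :
    Nat.card {ψ : free G ⟶ X // ψ ≫ φ = χ} = Nat.card {ψ : free G ⟶ X // ψ ≫ φ = χ'} := by
  obtain ⟨g, rfl⟩ := exists_rightMul_comp_eq χ χ'
  refine Nat.card_congr ((rightMulEquiv g X).subtypeEquiv fun ψ => ?_)
  rw [← (rightMulEquiv g Y).injective.eq_iff]
  simp [rightMulEquiv]

/-- The number of points of the transitive `G`-set `X`. -/
noncomputable def degree (X : OrbitCategory G) : ℕ := Nat.card (free G ⟶ X)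

theorem degree_eq_index (X : OrbitCategory G) : X.degree = X.subgroup.index :=
  Nat.card_congr (freeHomEquiv X)

end Group

section Finite

variable {G : Type u} [Group G] [Finite G]

instance finite_hom (X Y : OrbitCategory G) : Finite (X ⟶ Y) :=
  Finite.of_injective (fun φ : X ⟶ Y => (toMap φ : G ⧸ X.subgroup → G ⧸ Y.subgroup))
    fun _ _ h => MulActionHom.ext (congrFun h)

noncomputable instance fintypeHom (X Y : OrbitCategory G) : Fintype (X ⟶ Y) := Fintype.ofFinite _

theorem degree_pos (X : OrbitCategory G) : 0 < X.degree := by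
  rw [degree_eq_index]
  exact Nat.pos_of_ne_zero X.subgroup.index_ne_zero_of_finite

theorem card_fibre_mul_degree {X Y : OrbitCategory G} (φ : X ⟶ Y) (χ : free G ⟶ Y) :
    Nat.card {ψ : free G ⟶ X // ψ ≫ φ = χ} * Y.degree = X.degree := by
  have h := Nat.card_congr (Equiv.sigmaFiberEquiv fun ψ : free G ⟶ X => ψ ≫ φ)
  rw [Nat.card_sigma, Finset.sum_congr rfl fun χ' _ => card_fibre_eq φ χ' χ, Finset.sum_const,
    Finset.card_univ, ← Nat.card_eq_fintype_card, smul_eq_mul, mul_comm] at h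
  exact h

theorem card_fibre {X Y : OrbitCategory G} (φ : X ⟶ Y) (χ : free G ⟶ Y) :
    Nat.card {ψ : free G ⟶ X // ψ ≫ φ = χ} = X.degree / Y.degree := by
  rw [← card_fibre_mul_degree φ χ, Nat.mul_div_cancel _ Y.degree_pos]

theorem degree_dvd {X Y : OrbitCategory G} (φ : X ⟶ Y) : Y.degree ∣ X.degree :=
  Dvd.intro_left _ (card_fibre_mul_degree φ (ofPoint ((1 : G) : G ⧸ Y.subgroup)))

theorem isIso_of_degree_eq {X Y : OrbitCategory G} (φ : X ⟶ Y) (h : X.degree = Y.degree) :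
    IsIso φ := by
  rw [degree_eq_index, degree_eq_index] at h
  exact isIso_of_bijective φ ((Nat.bijective_iff_surjective_and_card _).2 ⟨toMap_surjective φ, h⟩)

/-- The ratio divides the index of a subgroup, so it is a power of p; if it is 1, the surjection φ
is bijective. -/
theorem cast_degree_div_eq_zero_or_isIso {p : ℕ} [Fact p.Prime] (hG : IsPGroup p G)
    {X Y : OrbitCategory G} (φ : X ⟶ Y) :
    ((X.degree / Y.degree : ℕ) : ZMod p) = 0 ∨ IsIso φ := by
  obtain ⟨k, hk⟩ := hG.index X.subgroup
  have hdvd : X.degree / Y.degree ∣ p ^ k := by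
    rw [← hk, ← degree_eq_index]
    exact Nat.div_dvd_of_dvd (degree_dvd φ)
  obtain ⟨j, -, hj⟩ := (Nat.dvd_prime_pow Fact.out).1 hdvd
  rcases j with _ | j
  · right
    apply isIso_of_degree_eq
    rw [← Nat.div_mul_cancel (degree_dvd φ), hj, pow_zero, one_mul]
  · left
    rw [hj, pow_succ]
    simp

end Finite

end OrbitCategory

namespace OrbitCategory

variable {G : Type u} [Group G]

instance [Finite G] : Finite (OrbitCategory G) :=
  Finite.of_injective subgroup fun ⟨_⟩ ⟨_⟩ h => congrArg mk h

noncomputable instance [Finite G] : Fintype (OrbitCategory G) := Fintype.ofFinite _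

/-- Precomposition with `φ`, as a map between the sets of all morphisms with a given source. -/
def precomp {X Y : OrbitCategory G} (φ : X ⟶ Y) :
    (Σ H : OrbitCategory G, Y ⟶ H) → Σ H : OrbitCategory G, X ⟶ H :=
  fun i => ⟨i.1, φ ≫ i.2⟩

theorem precomp_injective {X Y : OrbitCategory G} (φ : X ⟶ Y) :
    Function.Injective (precomp φ) := by
  rintro ⟨H, ψ⟩ ⟨K, χ⟩ h
  obtain rfl : H = K := congrArg Sigma.fst h
  have h' : φ ≫ ψ = φ ≫ χ := eq_of_heq (Sigma.mk.inj h).2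
  rw [(cancel_epi φ).1 h']

end OrbitCategory

/-! ### Transfers, free covers and the splitting -/

namespace CoefficientSystem

open OrbitCategory Opposite

section Transfer

variable {G : Type u} [Group G] {R : Type v} [CommRing R]

theorem hom_naturality {M N : CoefficientSystem.{w} G R} (f : M ⟶ N) {X Y : OrbitCategory G}
    (φ : X ⟶ Y) (y : M.obj (op Y)) :
    (f.app (op X)).hom ((M.map φ.op).hom y) = (N.map φ.op).hom ((f.app (op Y)).hom y) :=
  LinearMap.congr_fun (congrArg ModuleCat.Hom.hom (f.naturality φ.op)) y

theorem map_comp_apply (M : CoefficientSystem.{w} G R) {X Y Z : OrbitCategory G}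
    (φ : X ⟶ Y) (ψ : Y ⟶ Z) (z : M.obj (op Z)) :
    (M.map φ.op).hom ((M.map ψ.op).hom z) = (M.map (φ ≫ ψ).op).hom z := by
  rw [op_comp, M.map_comp]
  rfl

variable [Finite G]

/-- The transfer of a coefficient system: the sum of the restrictions to the free transitive
`G`-set along all maps from it. -/
noncomputable def transfer (M : CoefficientSystem.{w} G R) (X : OrbitCategory G) :
    M.obj (op X) →ₗ[R] M.obj (op (free G)) :=
  ∑ ψ : free G ⟶ X, (M.map ψ.op).hom

theorem transfer_apply (M : CoefficientSystem.{w} G R) (X : OrbitCategory G) (x : M.obj (op X)) :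
    transfer M X x = ∑ ψ : free G ⟶ X, (M.map ψ.op).hom x := by
  simp [transfer]

theorem transfer_naturality {M N : CoefficientSystem.{w} G R} (f : M ⟶ N) (X : OrbitCategory G)
    (x : M.obj (op X)) :
    (f.app (op (free G))).hom (transfer M X x) = transfer N X ((f.app (op X)).hom x) := by
  simp only [transfer_apply, map_sum, hom_naturality]

/-- Grouping the maps ψ by ψ ≫ φ, each map to Y occurs as often as a fibre of φ has points. -/
theorem transfer_map (M : CoefficientSystem.{w} G R) {X Y : OrbitCategory G} (φ : X ⟶ Y)
    (y : M.obj (op Y)) :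
    transfer M X ((M.map φ.op).hom y) = ((X.degree / Y.degree : ℕ) : R) • transfer M Y y := by
  classical
  simp only [transfer_apply, map_comp_apply]
  rw [← Finset.sum_fiberwise (s := Finset.univ) (g := fun ψ : free G ⟶ X => ψ ≫ φ),
    Finset.smul_sum]
  refine Finset.sum_congr rfl fun χ _ => ?_
  rw [← card_fibre φ χ, Nat.card_eq_fintype_card, Fintype.card_subtype, Nat.cast_smul_eq_nsmul,
    ← Finset.sum_const]
  refine Finset.sum_congr rfl fun ψ hψ => ?_
  rw [(Finset.mem_filter.1 hψ).2]

theorem smul_mem_range_transfer (M : CoefficientSystem.{w} G R) {X Y : OrbitCategory G}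
    (φ : X ⟶ Y) {m : M.obj (op (free G))} (hm : m ∈ LinearMap.range (transfer M Y)) :
    ((X.degree / Y.degree : ℕ) : R) • m ∈ LinearMap.range (transfer M X) := by
  obtain ⟨y, rfl⟩ := hm
  exact ⟨_, transfer_map M φ y⟩

theorem range_transfer_le_of_isIso (M : CoefficientSystem.{w} G R) {X Y : OrbitCategory G}
    (φ : X ⟶ Y) [IsIso φ] :
    LinearMap.range (transfer M X) ≤ LinearMap.range (transfer M Y) := by
  rintro _ ⟨x, rfl⟩
  have h : x = (M.map φ.op).hom ((M.map (inv φ).op).hom x) := by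
    rw [map_comp_apply, IsIso.hom_inv_id, op_id, M.map_id]
    rfl
  rw [h, transfer_map]
  exact Submodule.smul_mem _ _ ⟨_, rfl⟩

theorem range_transfer_eq_of_isIso (M : CoefficientSystem.{w} G R) {X Y : OrbitCategory G}
    (φ : X ⟶ Y) [IsIso φ] :
    LinearMap.range (transfer M X) = LinearMap.range (transfer M Y) :=
  (range_transfer_le_of_isIso M φ).antisymm (range_transfer_le_of_isIso M (inv φ))

/-- The images of the transfer maps, as a quotient coefficient system: a morphism acts as
multiplication by the size of its fibres. -/
noncomputable def transferImage (M : CoefficientSystem.{w} G R) : CoefficientSystem.{w} G R where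
  obj X := ModuleCat.of R (LinearMap.range (transfer M X.unop))
  map {X Y} φ := ModuleCat.ofHom
    ((((Y.unop.degree / X.unop.degree : ℕ) : R) • LinearMap.id).restrict
      fun _ hm => smul_mem_range_transfer M φ.unop hm)
  map_id X := by
    ext m
    simp [Nat.div_self X.unop.degree_pos]
  map_comp {X Y Z} φ ψ := by
    ext m
    have h : Z.unop.degree / X.unop.degree =
        Z.unop.degree / Y.unop.degree * (Y.unop.degree / X.unop.degree) :=
      by
      refine Nat.div_eq_of_eq_mul_left X.unop.degree_pos ?_
      rw [mul_assoc, Nat.div_mul_cancel (degree_dvd φ.unop), Nat.div_mul_cancel (degree_dvd ψ.unop)]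
    simp only [h, Nat.cast_mul]
    simp [LinearMap.restrict_apply, mul_comm, mul_smul]

/-- The transfer maps as a morphism of coefficient systems. -/
noncomputable def toTransferImage (M : CoefficientSystem.{w} G R) : M ⟶ transferImage M where
  app X := ModuleCat.ofHom (transfer M X.unop).rangeRestrict
  naturality X Y φ := by
    ext x
    exact Subtype.ext (transfer_map M φ.unop x)

instance (M : CoefficientSystem.{w} G R) : Epi (toTransferImage M) := by
  have : ∀ X, Epi ((toTransferImage M).app X) := fun X =>
    (ModuleCat.epi_iff_surjective _).2 (transfer M X.unop).surjective_rangeRestrict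
  exact NatTrans.epi_of_epi_app _

end Transfer

section Free

variable {G : Type u} [Group G] {R : Type v} [CommRing R]

/-- The value at `X` of a free coefficient system covering `M`. -/
abbrev FreeCover (M : CoefficientSystem.{w} G R) (X : OrbitCategory G) :=
  (Σ H : OrbitCategory G, X ⟶ H) →₀ (∀ H : OrbitCategory G, M.obj (op H))

/-- The covering map from the free coefficient system. -/
noncomputable def freeCoverMap (M : CoefficientSystem.{w} G R) (X : OrbitCategory G) :
    FreeCover M X →ₗ[R] M.obj (op X) :=
  Finsupp.lsum R fun i => (M.map i.2.op).hom ∘ₗ LinearMap.proj i.1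

theorem freeCoverMap_single (M : CoefficientSystem.{w} G R) (X : OrbitCategory G)
    (i : Σ H : OrbitCategory G, X ⟶ H) (m : ∀ H : OrbitCategory G, M.obj (op H)) :
    freeCoverMap M X (Finsupp.single i m) = (M.map i.2.op).hom (m i.1) := by
  simp [freeCoverMap]

theorem freeCoverMap_surjective (M : CoefficientSystem.{w} G R) (X : OrbitCategory G) :
    Function.Surjective (freeCoverMap M X) := by
  classical
  intro x
  -- At an index (H, ψ), the cover reads only the H-component of the coefficient.
  refine ⟨Finsupp.single ⟨X, 𝟙 X⟩ (Pi.single X x), ?_⟩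
  rw [freeCoverMap_single, op_id, M.map_id, Pi.single_eq_same]
  rfl

theorem freeCoverMap_lmapDomain (M : CoefficientSystem.{w} G R) {X Y : OrbitCategory G}
    (φ : X ⟶ Y) (q : FreeCover M Y) :
    freeCoverMap M X (Finsupp.lmapDomain _ R (precomp φ) q) =
      (M.map φ.op).hom (freeCoverMap M Y q) := by
  induction q using Finsupp.induction_linear with
  | zero => simp only [map_zero]
  | add q r hq hr => simp only [map_add, hq, hr]
  | single i m =>
    rw [Finsupp.lmapDomain_apply, Finsupp.mapDomain_single, freeCoverMap_single,
      freeCoverMap_single, map_comp_apply]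
    rfl

variable [Finite G]

instance small_freeCover (M : CoefficientSystem.{w} G R) (X : OrbitCategory G) :
    Small.{w} (FreeCover M X) :=
  small_of_injective (DFunLike.coe_injective (F := FreeCover M X))

/-- The free coefficient system covering `M`, in the universe of `M`. -/
noncomputable def freeCover (M : CoefficientSystem.{w} G R) : CoefficientSystem.{w} G R where
  obj X := ModuleCat.of R (Shrink.{w} (FreeCover M X.unop))
  map φ := ModuleCat.ofHom ((Shrink.linearEquiv R _).symm.toLinearMap ∘ₗ
    Finsupp.lmapDomain _ R (precomp φ.unop) ∘ₗ (Shrink.linearEquiv R _).toLinearMap)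
  map_id X := by
    have h : precomp (𝟙 X.unop) = id := by
      funext i
      exact congrArg (Sigma.mk i.1) (Category.id_comp i.2)
    ext x
    simp [h]
  map_comp φ ψ := by
    have h : precomp (ψ.unop ≫ φ.unop) = precomp ψ.unop ∘ precomp φ.unop := by
      funext i
      exact congrArg (Sigma.mk i.1) (Category.assoc _ _ _)
    ext x
    simp [h, Finsupp.mapDomain_comp]

/-- The covering map from the free coefficient system, as a morphism. -/
noncomputable def fromFreeCover (M : CoefficientSystem.{w} G R) : freeCover M ⟶ M where
  app X := ModuleCat.ofHom (freeCoverMap M X.unop ∘ₗ (Shrink.linearEquiv R _).toLinearMap)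
  naturality X Y φ := by
    ext x
    change freeCoverMap M Y.unop (Shrink.linearEquiv R _ ((Shrink.linearEquiv R _).symm _)) = _
    rw [LinearEquiv.apply_symm_apply]
    exact freeCoverMap_lmapDomain M φ.unop (Shrink.linearEquiv R _ x)

instance (M : CoefficientSystem.{w} G R) : Epi (fromFreeCover M) := by
  have : ∀ X, Epi ((fromFreeCover M).app X) := fun X =>
    (ModuleCat.epi_iff_surjective _).2
      ((freeCoverMap_surjective M X.unop).comp (Shrink.linearEquiv R _).surjective)
  exact NatTrans.epi_of_epi_app _

theorem exists_section_freeCoverMap (M : CoefficientSystem.{w} G R) [Projective M] :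
    ∃ s : ∀ X : OrbitCategory G, M.obj (op X) →ₗ[R] FreeCover M X,
      (∀ X x, freeCoverMap M X (s X x) = x) ∧
      ∀ {X Y : OrbitCategory G} (φ : X ⟶ Y) (y : M.obj (op Y)),
        s X ((M.map φ.op).hom y) = Finsupp.mapDomain (precomp φ) (s Y y) := by
  let σ : M ⟶ freeCover M := Projective.factorThru (𝟙 M) (fromFreeCover M)
  have hσ : σ ≫ fromFreeCover M = 𝟙 M := Projective.factorThru_comp _ _
  refine ⟨fun X => (Shrink.linearEquiv R (FreeCover M X)).toLinearMap ∘ₗ (σ.app (op X)).hom,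
    fun X x => ?_, fun {X Y} φ y => ?_⟩
  · exact LinearMap.congr_fun (congrArg ModuleCat.Hom.hom (NatTrans.congr_app hσ (op X))) x
  · change Shrink.linearEquiv R _ ((σ.app (op X)).hom ((M.map φ.op).hom y)) = _
    rw [hom_naturality]
    exact LinearEquiv.apply_symm_apply _ _

/-- A section embeds M in a free system, where restriction maps basis elements injectively because
every φ is epi. -/
theorem map_injective_of_projective (M : CoefficientSystem.{w} G R) [Projective M]
    {X Y : OrbitCategory G} (φ : X ⟶ Y) : Function.Injective (M.map φ.op).hom := by
  obtain ⟨s, hs, hφ⟩ := exists_section_freeCoverMap M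
  intro x y h
  have h' := congrArg (s X) h
  rw [hφ, hφ] at h'
  rw [← hs Y x, Finsupp.mapDomain_injective (precomp_injective φ) h', hs]

/-- In a projective coefficient system, an invariant element at the free transitive `G`-set is a
sum of transfers. -/
theorem exists_eq_sum_transfer (M : CoefficientSystem.{w} G R) [Projective M]
    (m : M.obj (op (free G))) (hm : ∀ g : G, (M.map (rightMul g).op).hom m = m) :
    ∃ x : ∀ X : OrbitCategory G, M.obj (op X), m = ∑ X, transfer M X (x X) := by
  obtain ⟨s, hs, hφ⟩ := exists_section_freeCoverMap M
  -- The group permutes the maps free G ⟶ X transitively, so the coefficients of an invariant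
  -- element are constant on them and its expansion regroups into transfers.
  have hinv : ∀ (X : OrbitCategory G) (ψ χ : free G ⟶ X), s _ m ⟨X, ψ⟩ = s _ m ⟨X, χ⟩ := by
    intro X ψ χ
    obtain ⟨g, rfl⟩ := exists_rightMul_comp_eq ψ χ
    conv_rhs => rw [← hm g, hφ]
    exact (Finsupp.mapDomain_apply (precomp_injective (rightMul g)) (s _ m) ⟨X, ψ⟩).symm
  refine ⟨fun X => s _ m ⟨X, ofPoint ((1 : G) : G ⧸ X.subgroup)⟩ X, ?_⟩
  conv_lhs => rw [← hs _ m]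
  rw [freeCoverMap, Finsupp.lsum_apply, Finsupp.sum_fintype _ _ (fun i => map_zero _),
    Fintype.sum_sigma]
  refine Finset.sum_congr rfl fun X _ => ?_
  rw [transfer_apply]
  refine Finset.sum_congr rfl fun ψ _ => ?_
  rw [LinearMap.comp_apply, LinearMap.proj_apply, hinv X ψ]

end Free

section PGroup

variable {p : ℕ} [Fact p.Prime] {P : Type u} [Group P]

/-- The value of a coefficient system at the free transitive `P`-set, as a representation. -/
def representation {R : Type v} [CommRing R] (M : CoefficientSystem.{w} P R) :
    Representation R P (M.obj (op (free P))) where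
  toFun g := (M.map (rightMul g).op).hom
  map_one' := by
    rw [rightMul_one, op_id, M.map_id]
    rfl
  map_mul' g h := by
    rw [rightMul_mul, op_comp, M.map_comp]
    rfl

variable [Finite P]

/-- An endomorphism of a projective coefficient system which preserves all transfers is
invertible. -/
theorem isIso_of_transfer_eq (hP : IsPGroup p P) (E : CoefficientSystem.{w} P (ZMod p))
    [Projective E] (e : E ⟶ E)
    (he : ∀ (X : OrbitCategory P) (x : E.obj (op X)),
      transfer E X ((e.app (op X)).hom x) = transfer E X x) : IsIso e := by
  let h (X : OrbitCategory P) : Module.End (ZMod p) (E.obj (op X)) := (e.app (op X)).hom - 1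
  have hmap : ∀ {X Y : OrbitCategory P} (φ : X ⟶ Y) y,
      h X ((E.map φ.op).hom y) = (E.map φ.op).hom (h Y y) := by
    intro X Y φ y
    simp only [h, LinearMap.sub_apply, hom_naturality, map_sub, Module.End.one_apply]
  have hnil : ∀ x, ∃ n : ℕ, (h (free P) ^ n) x = 0 := by
    refine hP.exists_pow_apply_eq_zero (representation E) _ (fun g x => hmap _ x) fun x hx => ?_
    obtain ⟨y, rfl⟩ := exists_eq_sum_transfer E x hx
    simp [h, transfer_naturality, he]
  -- Nilpotence descends from the free orbit along the injective restriction.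
  have hnil' : ∀ (X : OrbitCategory P) x, ∃ n : ℕ, (h X ^ n) x = 0 := by
    intro X x
    let φ : free P ⟶ X := ofPoint ((1 : P) : P ⧸ X.subgroup)
    have hpow : ∀ n : ℕ, (h (free P) ^ n) ((E.map φ.op).hom x) =
        (E.map φ.op).hom ((h X ^ n) x) := by
      intro n
      induction n with
      | zero => rfl
      | succ n ih => simp only [pow_succ', Module.End.mul_apply, ih, hmap]
    obtain ⟨n, hn⟩ := hnil ((E.map φ.op).hom x)
    refine ⟨n, map_injective_of_projective E φ ?_⟩
    rw [← hpow, hn, map_zero]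
  have : ∀ X, IsIso (e.app X) := by
    intro X
    rw [ConcreteCategory.isIso_iff_bijective]
    have hb := Module.End.bijective_one_add_of_locally_nilpotent (h X.unop) (hnil' X.unop)
    rw [add_sub_cancel] at hb
    exact hb
  exact (NatTrans.isIso_iff_isIso_app e).2 this

/-- A morphism to the transfer image given by retractions of the transfers along a monomorphism. -/
theorem exists_retraction_transferImage (hP : IsPGroup p P)
    {E F : CoefficientSystem.{w} P (ZMod p)} (f : E ⟶ F) [Mono f] :
    ∃ r : F ⟶ transferImage E, f ≫ r = toTransferImage E := by
  have hf : Function.Injective (f.app (op (free P))).hom :=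
    (ModuleCat.mono_iff_injective _).1 inferInstance
  -- Retractions are chosen per subspace, not per orbit, so isomorphic orbits, having equal transfer
  -- images, share one.
  have hret : ∀ W : Submodule (ZMod p) (E.obj (op (free P))),
      ∃ ρ : F.obj (op (free P)) →ₗ[ZMod p] W, ∀ m : W, ρ ((f.app (op (free P))).hom m) = m := by
    intro W
    obtain ⟨ρ, hρ⟩ := ((f.app (op (free P))).hom ∘ₗ W.subtype).exists_leftInverse_of_injective
      (LinearMap.ker_eq_bot.2 (hf.comp W.injective_subtype))
    exact ⟨ρ, LinearMap.congr_fun hρ⟩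
  choose ρ hρ using hret
  have hρW : ∀ {V W : Submodule (ZMod p) (E.obj (op (free P)))}, V = W → ∀ m,
      (ρ V m : E.obj (op (free P))) = ρ W m := by
    rintro V _ rfl m
    rfl
  refine ⟨{ app X := ModuleCat.ofHom (ρ (LinearMap.range (transfer E X.unop)) ∘ₗ
              transfer F X.unop)
            naturality X Y φ := ?_ }, ?_⟩
  · ext y
    apply Subtype.ext
    have hφ := transfer_map F φ.unop y
    change ((ρ _ (transfer F Y.unop ((F.map φ.unop.op).hom y)) :
        LinearMap.range (transfer E Y.unop)) : E.obj (op (free P))) =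
      ((Y.unop.degree / X.unop.degree : ℕ) : ZMod p) •
        (ρ (LinearMap.range (transfer E X.unop)) (transfer F X.unop y)).1
    rw [hφ, map_smul, Submodule.coe_smul]
    rcases cast_degree_div_eq_zero_or_isIso hP φ.unop with h0 | hiso
    · rw [h0, zero_smul, zero_smul]
    · rw [hρW (range_transfer_eq_of_isIso E φ.unop)]
  · ext X x
    apply Subtype.ext
    have hx := transfer_naturality f X.unop x
    change ((ρ _ (transfer F X.unop ((f.app X).hom x)) :
        LinearMap.range (transfer E X.unop)) : E.obj (op (free P))) = transfer E X.unop x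
    rw [← hx]
    exact congrArg Subtype.val (hρ (LinearMap.range (transfer E X.unop)) ⟨transfer E X.unop x, x, rfl⟩)

end PGroup

end CoefficientSystem

open CoefficientSystem in
theorem lemma4 (p : ℕ) [Fact p.Prime] (P : Type u) [Group P] [Finite P] (hP : IsPGroup p P)
    (E F : CoefficientSystem.{w} P (ZMod p)) (hE : Projective E) (hF : Projective F)
    (f : E ⟶ F) (hf : Mono f) : IsSplitMono f := by
  obtain ⟨ρ, hρ⟩ := exists_retraction_transferImage hP f
  -- The quotient map is epi, so ρ lifts through it; f ≫ r need not be the identity, only preserve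
  -- transfers.
  let r : F ⟶ E := Projective.factorThru ρ (toTransferImage E)
  have hr : (f ≫ r) ≫ toTransferImage E = toTransferImage E := by
    rw [Category.assoc, Projective.factorThru_comp, hρ]
  have : IsIso (f ≫ r) := isIso_of_transfer_eq hP E (f ≫ r) fun X x =>
    congrArg Subtype.val (LinearMap.congr_fun
      (congrArg ModuleCat.Hom.hom (NatTrans.congr_app hr (Opposite.op X))) x)
  exact ⟨⟨⟨r ≫ inv (f ≫ r), by rw [← Category.assoc, IsIso.hom_inv_id]⟩⟩⟩
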